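/- Let $N\ge 1$ and let $\mathcal O_1,\dots,\mathcal O_N\subset\mathbb R^2$ be convex polygons (convex hulls of finitely many points, with nonempty interior). Fix $\rho>0$ and let $\bar{\mathcal O}_k=\mathcal O_k\oplus B(\rho)$ be the Minkowski sum of $\mathcal O_k$ and the ball of radius $\rho$ centred at the origin. Let $P_r(\bar{\mathcal O}_k)$ be the perimeter (length of the boundary) of $\bar{\mathcal O}_k$, let $\rho_k^{in}$ be the minimum distance from the centroid of $\mathcal O_k$ to a point of $\partial\bar{\mathcal O}_k$, and let $$\mathcal K_m=\max_{1\le k\le N}\frac{P_r(\bar{\mathcal O}_k)}{4\rho_k^{in}} .$$ Let $r_p,r_q\in\mathbb R^2$. A path avoids an obstacle $\bar{\mathcal O}_k$ if it does not enter its interior (it may run along the boundary). Let $L_s(r_p,r_q)\in[0,\infty]$ be the geodesic length, i.e. the infimum of the lengths of the continuous paths from $r_p$ to $r_q$ that avoid all the $\bar{\mathcal O}_k$; a shortest path is such a path of finite length that no other one undercuts. Let $$E=\{r\in\mathbb R^2:\ \|r_p-r\|+\|r_q-r\|\le \mathcal K_m\,L_s(r_p,r_q)\}$$ be the region bounded by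 the ellipse with foci $r_p,r_q$ given by $\|r_p-r\|+\|r_q-r\|=\mathcal K_m L_s(r_p,r_q)$ (the whole plane if $L_s(r_p,r_q)=\infty$). Then: (i) every shortest path from $r_p$ to $r_q$ avoiding all the obstacles lies in $E$; (ii) only the obstacles that meet $E$ need to be considered: if all $\bar{\mathcal O}_k$ with $\bar{\mathcal O}_k\cap E=\emptyset$ are discarded, then the geodesic length from $r_p$ to $r_q$ and the set of shortest paths from $r_p$ to $r_q$ do not change. -/

import Mathlib

open scoped ENNReal Pointwise MeasureTheory

namespace EllipseFilter

/-- The Euclidean plane. -/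
abbrev Plane : Type := EuclideanSpace ℝ (Fin 2)

/-- The convex polygon spanned by finitely many points. -/
def polygon {m : ℕ} (v : Fin m → Plane) : Set Plane :=
  convexHull ℝ (Set.range v)

/-- The inflated obstacle: Minkowski sum of the polygon and the ball of radius `ρ` about `0`. -/
def inflated {m : ℕ} (v : Fin m → Plane) (ρ : ℝ) : Set Plane :=
  polygon v + Metric.closedBall (0 : Plane) ρ

/-- The perimeter of a planar region: the length (one-dimensional Hausdorff measure)
of its boundary. -/
noncomputable def perimeter (A : Set Plane) : ℝ≥0∞ :=
  MeasureTheory.Measure.hausdorffMeasure 1 (frontier A)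

/-- The centroid (centre of mass of the region) of the polygon. -/
noncomputable def centroid {m : ℕ} (v : Fin m → Plane) : Plane :=
  ⨍ x in polygon v, x

/-- The minimum distance from the centroid of the polygon to the boundary of the inflated
obstacle. -/
noncomputable def innerRadius {m : ℕ} (v : Fin m → Plane) (ρ : ℝ) : ℝ≥0∞ :=
  Metric.infEDist (centroid v) (frontier (inflated v ρ))

/-- The maximum over the obstacles of perimeter divided by four times the inner radius. -/
noncomputable def ellipseFactor {N : ℕ} {M : Fin N → ℕ} (v : (k : Fin N) → Fin (M k) → Plane)
    (ρ : ℝ) : ℝ≥0∞ :=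
  ⨆ k : Fin N, perimeter (inflated (v k) ρ) / (4 * innerRadius (v k) ρ)

/-- The points that are not interior to any inflated obstacle whose index lies in `S`
(paths may run along the boundaries of the inflated obstacles). -/
def freeSpace {N : ℕ} {M : Fin N → ℕ} (v : (k : Fin N) → Fin (M k) → Plane) (ρ : ℝ)
    (S : Set (Fin N)) : Set Plane :=
  {r | ∀ k ∈ S, r ∉ interior (inflated (v k) ρ)}

/-- The length of a continuous path: the supremum of the lengths of inscribed polygonal lines. -/
noncomputable def pathLength {p q : Plane} (γ : Path p q) : ℝ≥0∞ :=
  eVariationOn (fun t : unitInterval => γ t) Set.univ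

/-- The geodesic distance in `F`: infimum of the lengths of the paths from `p` to `q` inside `F`
(`∞` if there is no such path of finite length). -/
noncomputable def geodesicLength (F : Set Plane) (p q : Plane) : ℝ≥0∞ :=
  ⨅ (γ : Path p q) (_ : ∀ t, γ t ∈ F), pathLength γ

/-- `γ` is a shortest path in `F`: it stays in `F`, has finite length, and no path in `F` with the
same endpoints is shorter. -/
def IsShortestPath (F : Set Plane) {p q : Plane} (γ : Path p q) : Prop :=
  (∀ t, γ t ∈ F) ∧ pathLength γ ≠ ⊤ ∧
    ∀ γ' : Path p q, (∀ t, γ' t ∈ F) → pathLength γ ≤ pathLength γ'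

/-- The closed region bounded by the ellipse with foci `p`, `q` and distance sum `s`. -/
def ellipseRegion (p q : Plane) (s : ℝ≥0∞) : Set Plane :=
  {r | edist p r + edist q r ≤ s}

/-- The region of the ellipse filter: the ellipse with foci `p`, `q` whose distance sum is
the ellipse factor times the geodesic distance from `p` to `q` among all the obstacles. -/
noncomputable def filterRegion {N : ℕ} {M : Fin N → ℕ} (v : (k : Fin N) → Fin (M k) → Plane)
    (ρ : ℝ) (p q : Plane) : Set Plane :=
  ellipseRegion p q (ellipseFactor v ρ * geodesicLength (freeSpace v ρ Set.univ) p q)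

/-- The indices of the inflated obstacles that meet the region of the ellipse filter. -/
def relevantObstacles {N : ℕ} {M : Fin N → ℕ} (v : (k : Fin N) → Fin (M k) → Plane)
    (ρ : ℝ) (p q : Plane) : Set (Fin N) :=
  {k | (inflated (v k) ρ ∩ filterRegion v ρ p q).Nonempty}

end EllipseFilter

/-!
The ellipse factor is at least `1`, and this is all that the filter needs.  A point of a path from
`p` to `q` splits it into two parts, so its distances to `p` and `q` add up to at most the length
of the path (`edist_add_edist_le_pathLength`).  A path no longer than the geodesic distance `L`
therefore stays in the ellipse region with distance sum `L`, which lies in the filter region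
(`mem_filterRegion`).  Such a path never meets an obstacle disjoint from the filter region, so
discarding these obstacles opens no route of length at most `L`.

The factor is at least `1` because a bounded region that contains a disc of radius `r` in its
interior has perimeter at least `4 * r`: every vertical line through the disc meets the boundary
both above and below the horizontal diameter.  The projections of these two parts of the boundary
to the horizontal axis thus both cover an interval of length `2 * r`, and projecting does not
increase length
(`four_mul_infEDist_frontier_le_perimeter`).
-/

namespace EllipseFilter

open MeasureTheory Measure Set Metric

/-! ### Perimeter and distance to the boundary -/

/-- If the vertical line through every point of a set `I` of abscissae meets `s`, then `s` is at
least as long as `I`, because the projection to the first axis is `1`-Lipschitz. -/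
lemma volume_le_hausdorffMeasure_of_subset_image {s : Set Plane} {I : Set ℝ}
    (h : I ⊆ (fun x : Plane => x 0) '' s) : volume I ≤ μH[1] s := by
  have hL : LipschitzWith 1 (fun x : Plane => x 0) :=
    LipschitzWith.of_dist_le_mul fun x y => by
      simpa [dist_eq_norm] using PiLp.norm_apply_le (x - y) 0
  calc volume I = μH[1] I := by rw [hausdorffMeasure_real]
    _ ≤ μH[1] ((fun x : Plane => x 0) '' s) := measure_mono h
    _ ≤ μH[1] s := by simpa using hL.hausdorffMeasure_image_le (d := 1) zero_le_one s

lemma inter_frontier_nonempty_of_isPreconnected {X : Type*} [TopologicalSpace X] {s A : Set X}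
    (hs : IsPreconnected s) (h : (s ∩ A).Nonempty) (h' : (s ∩ Aᶜ).Nonempty) :
    (s ∩ frontier A).Nonempty := by
  by_contra hf
  rw [not_nonempty_iff_eq_empty, ← disjoint_iff_inter_eq_empty,
    ← subset_compl_iff_disjoint_right, compl_frontier_eq_union_interior] at hf
  obtain ⟨x, hxs, hxA⟩ := h
  obtain ⟨y, hys, hyA⟩ := h'
  obtain ⟨z, -, hz, hz'⟩ := hs _ _ isOpen_interior isOpen_interior hf
    ⟨x, hxs, (hf hxs).resolve_right fun hx => interior_subset hx hxA⟩
    ⟨y, hys, (hf hys).resolve_left fun hy => hyA (interior_subset hy)⟩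
  exact interior_subset hz' (interior_subset hz)

/-- A ray that starts in the interior of a bounded set meets the frontier of the set after its
starting point. -/
lemma exists_pos_add_smul_mem_frontier {A : Set Plane} (hA : Bornology.IsBounded A) {x e : Plane}
    (hx : x ∈ interior A) (he : e ≠ 0) : ∃ t : ℝ, 0 < t ∧ x + t • e ∈ frontier A := by
  have hpre : IsPreconnected ((fun t : ℝ => x + t • e) '' Ici 0) :=
    isPreconnected_Ici.image _ (by fun_prop)
  obtain ⟨_, ⟨t, ht, rfl⟩, htf⟩ := inter_frontier_nonempty_of_isPreconnected hpre (A := A)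
    ⟨x, ⟨0, self_mem_Ici, by simp⟩, interior_subset hx⟩ (by
      obtain ⟨R, hR⟩ := hA.subset_closedBall x
      have he' : 0 < ‖e‖ := norm_pos_iff.2 he
      have hT : 0 ≤ (|R| + 1) / ‖e‖ := by positivity
      refine ⟨_, ⟨_, hT, rfl⟩, fun hmem => ?_⟩
      have := hR hmem
      rw [mem_closedBall, dist_eq_norm, add_sub_cancel_left, norm_smul, Real.norm_of_nonneg hT,
        div_mul_cancel₀ _ he'.ne'] at this
      linarith [le_abs_self R])
  refine ⟨t, lt_of_le_of_ne ht ?_, htf⟩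
  rintro rfl
  exact htf.2 (by simpa using hx)

lemma frontier_nonempty {A : Set Plane} (hA : Bornology.IsBounded A) {c : Plane}
    (hc : c ∈ interior A) : (frontier A).Nonempty :=
  have ⟨_, _, ht⟩ := exists_pos_add_smul_mem_frontier hA hc (e := EuclideanSpace.single 1 1)
    (by simp)
  ⟨_, ht⟩

/-- A ball that is centred in a set and does not reach the frontier lies in the interior. -/
lemma ball_infDist_frontier_subset_interior {A : Set Plane} {c : Plane} (hc : c ∈ A) :
    ball c (infDist c (frontier A)) ⊆ interior A := by
  refine interior_maximal (fun x hx => ?_) isOpen_ball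
  by_contra hxA
  have hr : 0 < infDist c (frontier A) := dist_nonneg.trans_lt (mem_ball.1 hx)
  obtain ⟨y, hy, hyf⟩ := inter_frontier_nonempty_of_isPreconnected (A := A)
    (convex_ball c (infDist c (frontier A))).isPreconnected
    ⟨c, mem_ball_self hr, hc⟩ ⟨x, hx, hxA⟩
  exact (infDist_le_dist_of_mem hyf).not_gt (mem_ball'.1 hy)

/-- The perimeter of a bounded set is at least four times the distance from an interior point to
the boundary. -/
lemma four_mul_infEDist_frontier_le_perimeter {A : Set Plane}
    (hA : Bornology.IsBounded A) {c : Plane} (hc : c ∈ interior A) :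
    4 * infEDist c (frontier A) ≤ perimeter A := by
  have hne := frontier_nonempty hA hc
  set r : ℝ := infDist c (frontier A)
  have hr' : infEDist c (frontier A) = ENNReal.ofReal r :=
    (ENNReal.ofReal_toReal (infEDist_ne_top hne)).symm
  -- The ray argument runs vertically, both ways, from the points of this horizontal diameter.
  have hdiam : ∀ a ∈ Ioo (c 0 - r) (c 0 + r),
      c + (a - c 0) • EuclideanSpace.single 0 1 ∈ interior A := fun a ha => by
    refine ball_infDist_frontier_subset_interior (interior_subset hc) ?_
    rw [mem_ball, dist_eq_norm, add_sub_cancel_left, norm_smul]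
    simpa [abs_lt] using ⟨by linarith [ha.1], by linarith [ha.2]⟩
  have hup : volume (Ioo (c 0 - r) (c 0 + r)) ≤ μH[1] (frontier A ∩ {x | c 1 < x 1}) := by
    refine volume_le_hausdorffMeasure_of_subset_image fun a ha => ?_
    obtain ⟨t, ht, hf⟩ := exists_pos_add_smul_mem_frontier hA (hdiam a ha)
      (e := EuclideanSpace.single 1 1) (by simp)
    exact ⟨_, ⟨hf, by simpa using ht⟩, by simp⟩
  have hdown : volume (Ioo (c 0 - r) (c 0 + r)) ≤ μH[1] (frontier A \ {x | c 1 < x 1}) := by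
    refine volume_le_hausdorffMeasure_of_subset_image fun a ha => ?_
    obtain ⟨t, ht, hf⟩ := exists_pos_add_smul_mem_frontier hA (hdiam a ha)
      (e := EuclideanSpace.single 1 (-1)) (by simp)
    exact ⟨_, ⟨hf, by simpa using ht.le⟩, by simp⟩
  have hmeas : MeasurableSet {x : Plane | c 1 < x 1} :=
    (isOpen_lt continuous_const (by fun_prop)).measurableSet
  calc 4 * infEDist c (frontier A)
      = volume (Ioo (c 0 - r) (c 0 + r)) + volume (Ioo (c 0 - r) (c 0 + r)) := by
        have h0 : 0 ≤ r := infDist_nonneg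
        rw [hr', Real.volume_Ioo, ← ENNReal.ofReal_add (by linarith) (by linarith),
          show (4 : ℝ≥0∞) = ENNReal.ofReal 4 by simp, ← ENNReal.ofReal_mul (by norm_num)]
        ring_nf
    _ ≤ _ := add_le_add hup hdown
    _ = perimeter A := measure_inter_add_sdiff _ hmeas

/-! ### The ellipse factor -/

lemma isCompact_polygon {m : ℕ} (v : Fin m → Plane) : IsCompact (polygon v) :=
  (finite_range v).isCompact_convexHull ℝ

lemma centroid_mem_polygon {m : ℕ} {v : Fin m → Plane} (hv : (interior (polygon v)).Nonempty) :
    centroid v ∈ polygon v :=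
  have hK := isCompact_polygon v
  (convex_convexHull ℝ _).set_average_mem hK.isClosed
    (measure_pos_of_nonempty_interior _ hv).ne' hK.measure_lt_top.ne
    (ae_restrict_mem hK.measurableSet) (continuous_id.continuousOn.integrableOn_compact hK)

lemma polygon_subset_interior_inflated {m : ℕ} (v : Fin m → Plane) {ρ : ℝ} (hρ : 0 < ρ) :
    polygon v ⊆ interior (inflated v ρ) := fun x hx => by
  have hsub : polygon v + ball 0 ρ ⊆ interior (inflated v ρ) :=
    interior_maximal (add_subset_add_left ball_subset_closedBall) isOpen_ball.add_left
  exact hsub (by simpa using add_mem_add hx (mem_ball_self (x := (0 : Plane)) hρ))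

lemma one_le_ellipseFactor {N : ℕ} (hN : 0 < N) {M : Fin N → ℕ}
    {v : (k : Fin N) → Fin (M k) → Plane} (hv : ∀ k, (interior (polygon (v k))).Nonempty)
    {ρ : ℝ} (hρ : 0 < ρ) : 1 ≤ ellipseFactor v ρ := by
  let k : Fin N := ⟨0, hN⟩
  refine le_iSup_of_le k ?_
  have hb : Bornology.IsBounded (inflated (v k) ρ) :=
    (isCompact_polygon (v k)).isBounded.add isBounded_closedBall
  have hc : centroid (v k) ∈ interior (inflated (v k) ρ) :=
    polygon_subset_interior_inflated (v k) hρ (centroid_mem_polygon (hv k))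
  have hpos : innerRadius (v k) ρ ≠ 0 := fun h =>
    ((mem_iff_infEDist_zero_of_closed isClosed_frontier).2 h).2 hc
  have htop : innerRadius (v k) ρ ≠ ⊤ := infEDist_ne_top (frontier_nonempty hb hc)
  rw [ENNReal.le_div_iff_mul_le (.inl (by simpa using hpos))
    (.inl (ENNReal.mul_ne_top (by simp) htop)), one_mul]
  exact four_mul_infEDist_frontier_le_perimeter hb hc

/-! ### Length and the sum of the distances to the endpoints -/

lemma edist_add_edist_le_pathLength {p q : Plane} (γ : Path p q) (t : unitInterval) :
    edist p (γ t) + edist q (γ t) ≤ pathLength γ := by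
  let f : unitInterval → Plane := fun s => γ s
  have h1 : edist p (γ t) ≤ eVariationOn f (Iic t) := by
    simpa [f] using eVariationOn.edist_le f (s := Iic t) (x := 0) (y := t) t.2.1
      (mem_Iic.2 le_rfl)
  have h2 : edist q (γ t) ≤ eVariationOn f (Ici t) := by
    simpa [f] using eVariationOn.edist_le f (s := Ici t) (x := 1) (y := t) t.2.2
      (mem_Ici.2 le_rfl)
  calc _ ≤ _ := add_le_add h1 h2
    _ ≤ eVariationOn f (Iic t ∪ Ici t) :=
      eVariationOn.add_le_union f fun _ hx _ hy => le_trans hx hy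
    _ = pathLength γ := by rw [Iic_union_Ici]; rfl

/-! ### Discarding the irrelevant obstacles -/

section Filter

variable {N : ℕ} {M : Fin N → ℕ} {v : (k : Fin N) → Fin (M k) → Plane} {ρ : ℝ} {p q : Plane}

lemma mem_filterRegion (hK : 1 ≤ ellipseFactor v ρ) {γ : Path p q}
    (hγ : pathLength γ ≤ geodesicLength (freeSpace v ρ univ) p q) (t : unitInterval) :
    γ t ∈ filterRegion v ρ p q :=
  calc _ ≤ pathLength γ := edist_add_edist_le_pathLength γ t
    _ ≤ 1 * geodesicLength (freeSpace v ρ univ) p q := by rwa [one_mul]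
    _ ≤ _ := by gcongr

lemma freeSpace_univ_subset (S : Set (Fin N)) : freeSpace v ρ univ ⊆ freeSpace v ρ S :=
  fun _ hr k _ => hr k (mem_univ k)

/-- A path no longer than the geodesic distance stays in the filter region, so it avoids all the
obstacles as soon as it avoids those that meet this region. -/
lemma mem_freeSpace_univ_of_pathLength_le (hK : 1 ≤ ellipseFactor v ρ) {γ : Path p q}
    (hγ : pathLength γ ≤ geodesicLength (freeSpace v ρ univ) p q)
    (hF : ∀ t, γ t ∈ freeSpace v ρ (relevantObstacles v ρ p q)) (t : unitInterval) :
    γ t ∈ freeSpace v ρ univ := fun k _ hk =>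
  hF t k ⟨γ t, interior_subset hk, mem_filterRegion hK hγ t⟩ hk

lemma geodesicLength_le {F : Set Plane} {γ : Path p q} (hγ : ∀ t, γ t ∈ F) :
    geodesicLength F p q ≤ pathLength γ :=
  iInf₂_le γ hγ

lemma IsShortestPath.pathLength_eq {F : Set Plane} {γ : Path p q} (h : IsShortestPath F γ) :
    pathLength γ = geodesicLength F p q :=
  le_antisymm (le_iInf₂ h.2.2) (geodesicLength_le h.1)

lemma geodesicLength_relevantObstacles (hK : 1 ≤ ellipseFactor v ρ) :
    geodesicLength (freeSpace v ρ (relevantObstacles v ρ p q)) p q =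
      geodesicLength (freeSpace v ρ univ) p q := by
  refine le_antisymm (le_iInf₂ fun γ hγ => geodesicLength_le fun t =>
    freeSpace_univ_subset _ (hγ t)) (le_iInf₂ fun γ hγ => ?_)
  rcases le_total (geodesicLength (freeSpace v ρ univ) p q) (pathLength γ) with h | h
  · exact h
  · exact geodesicLength_le (mem_freeSpace_univ_of_pathLength_le hK h hγ)

end Filter

end EllipseFilter

theorem corollary1 {N : ℕ} (hN : 0 < N) {M : Fin N → ℕ}
    (v : (k : Fin N) → Fin (M k) → EllipseFilter.Plane)
    (hv : ∀ k, (interior (EllipseFilter.polygon (v k))).Nonempty)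
    (ρ : ℝ) (hρ : 0 < ρ) (p q : EllipseFilter.Plane) :
    (∀ γ : Path p q,
      EllipseFilter.IsShortestPath (EllipseFilter.freeSpace v ρ Set.univ) γ →
        ∀ t, γ t ∈ EllipseFilter.filterRegion v ρ p q) ∧
    EllipseFilter.geodesicLength
        (EllipseFilter.freeSpace v ρ (EllipseFilter.relevantObstacles v ρ p q)) p q =
      EllipseFilter.geodesicLength (EllipseFilter.freeSpace v ρ Set.univ) p q ∧
    (∀ γ : Path p q,
      EllipseFilter.IsShortestPath
          (EllipseFilter.freeSpace v ρ (EllipseFilter.relevantObstacles v ρ p q)) γ ↔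
        EllipseFilter.IsShortestPath (EllipseFilter.freeSpace v ρ Set.univ) γ) := by
  have hK := EllipseFilter.one_le_ellipseFactor hN hv hρ
  have hL := EllipseFilter.geodesicLength_relevantObstacles (p := p) (q := q) hK
  refine ⟨fun γ hγ => EllipseFilter.mem_filterRegion hK hγ.pathLength_eq.le, hL,
    fun γ => ⟨fun hγ => ?_, fun hγ => ?_⟩⟩
  · have hF := EllipseFilter.mem_freeSpace_univ_of_pathLength_le hK
      (hγ.pathLength_eq.trans hL).le hγ.1
    exact ⟨hF, hγ.2.1, fun γ' h' => hγ.2.2 γ' fun t =>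
      EllipseFilter.freeSpace_univ_subset _ (h' t)⟩
  · refine ⟨fun t => EllipseFilter.freeSpace_univ_subset _ (hγ.1 t), hγ.2.1, fun γ' h' => ?_⟩
    rw [hγ.pathLength_eq, ← hL]
    exact EllipseFilter.geodesicLength_le h'
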